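/- Let $n\ge 1$ and $\triangle=\{(x_1,\dots,x_n)\in\mathbb R^n : 1\ge x_1\ge\cdots\ge x_n\ge 0\}$. For each integer $b\ge 0$ let $$\triangle_b=\{x\in\triangle : 1-x_1-b\,x_n\ge 0>1-x_1-(b+1)x_n\},$$ and define the triangle map on $\bigcup_{b\ge 0}\triangle_b$ by $$T(x_1,\dots,x_n)=\Bigl(\frac{x_2}{x_1},\dots,\frac{x_n}{x_1},\frac{1-x_1-b\,x_n}{x_1}\Bigr)\qquad (x\in\triangle_b).$$ A triangle sequence of $x\in\triangle$ is a sequence $(b_0,b_1,b_2,\dots)$ of non-negative integers with $T^k(x)\in\triangle_{b_k}$ for all $k\ge 0$; there is at most one. Theorem. (1) Lebesgue-almost every $x\in\triangle$ has a triangle sequence, and it contains infinitely many strings of $n-1$ consecutive zeros: there are infinitely many $k\ge 0$ with $b_k=b_{k+1}=\cdots=b_{k+n-2}=0$. (2) For every real number $B\ge 0$ and Lebesgue-almost every $x\in\triangle$, the triangle sequence of $x$ exists and contains infinitely many strings of length $n-1$ bounded by $B$: there are infinitely many $k\ge 0$ with $b_k,b_{k+1},\dots,b_{k+n-2}\le B$.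 (For $n=1$ the strings are empty and the condition on them is vacuous.) -/

import Mathlib

open MeasureTheory

noncomputable section

namespace TriangleMap

/-- The simplex `1 ≥ x₁ ≥ ⋯ ≥ xₙ ≥ 0` in `ℝⁿ`, where `n = d + 1` ranges over all dimensions `n ≥ 1`.
The coordinate `x₁` is `x 0` and `xₙ` is `x (Fin.last d)`. -/
def simplex (d : ℕ) : Set (Fin (d + 1) → ℝ) :=
  {x | x 0 ≤ 1 ∧ Antitone x ∧ 0 ≤ x (Fin.last d)}

/-- The piece `△_b` of the simplex: `1 - x₁ - b xₙ ≥ 0 > 1 - x₁ - (b + 1) xₙ`. -/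
def cell (d b : ℕ) : Set (Fin (d + 1) → ℝ) :=
  {x | x ∈ simplex d ∧ 1 - x 0 - (b : ℝ) * x (Fin.last d) ≥ 0 ∧
    0 > 1 - x 0 - ((b : ℝ) + 1) * x (Fin.last d)}

/-- The number `b = ⌊(1 - x₁) / xₙ⌋`; it is the index of the piece that contains `x`
(see `digit_eq_of_mem_cell`). -/
def digit {d : ℕ} (x : Fin (d + 1) → ℝ) : ℕ :=
  ⌊(1 - x 0) / x (Fin.last d)⌋₊

/-- The triangle map
`T (x₁, …, xₙ) = (x₂ / x₁, …, xₙ / x₁, (1 - x₁ - b xₙ) / x₁)` for `x ∈ △_b`.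
Its values outside the union of the pieces `△_b` (that is, where `xₙ = 0`) are irrelevant. -/
def T {d : ℕ} (x : Fin (d + 1) → ℝ) : Fin (d + 1) → ℝ :=
  Fin.snoc (α := fun _ => ℝ) (fun i : Fin d => x i.succ / x 0)
    ((1 - x 0 - (digit x : ℝ) * x (Fin.last d)) / x 0)

/-- `b` is the triangle sequence of `x`: `x ∈ △_{b₀}`, `T x ∈ △_{b₁}`, `T² x ∈ △_{b₂}`, …
There is at most one such `b` (see `IsTriangleSequence.unique`), and none if the orbit of `x`
leaves the union of the pieces. -/
def IsTriangleSequence {d : ℕ} (x : Fin (d + 1) → ℝ) (b : ℕ → ℕ) : Prop :=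
  ∀ k, (T^[k] x) ∈ cell d (b k)

theorem digit_eq_of_mem_cell {d b : ℕ} {x : Fin (d + 1) → ℝ} (hx : x ∈ cell d b) :
    digit x = b := by
  obtain ⟨⟨h1, -, h0⟩, hl, hu⟩ := hx
  have hpos : 0 < x (Fin.last d) := by
    rcases h0.lt_or_eq with h | h
    · exact h
    · rw [← h] at hl hu
      linarith
  unfold digit
  rw [Nat.floor_eq_iff (div_nonneg (by linarith) h0), le_div_iff₀ hpos, div_lt_iff₀ hpos]
  constructor <;> linarith

theorem IsTriangleSequence.unique {d : ℕ} {x : Fin (d + 1) → ℝ} {b c : ℕ → ℕ}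
    (hb : IsTriangleSequence x b) (hc : IsTriangleSequence x c) : b = c :=
  funext fun k => (digit_eq_of_mem_cell (hb k)).symm.trans (digit_eq_of_mem_cell (hc k))

end TriangleMap

end

/-!
In the homogeneous coordinates `(1 - x₁, x₁ - x₂, …, xₙ₋₁ - xₙ, xₙ)` the triangle map is piecewise
linear on the positive orthant, with one inverse branch of determinant `±1` for each digit. Give the
coordinates independent exponential laws of rates `L`. Conditioned on the first digit `b`, the image
point again has independent exponential coordinates, of rates `L ᵥ* branch b`, so the digits are
governed by a Markov chain on rate vectors. The rates that occur are nondecreasing, and with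
probability bounded below the first `n` digits make the last rate comparable to the first one; from
then on any prescribed finite word of digits has probability bounded below. Hence, if `p` is the
supremum over such `L` of the probability of never seeing the word, conditioning on the first digits
bounds all these probabilities by some `q < p` unless `p = 0`.
-/

open Filter Matrix

namespace TriangleMap

section General

theorem measureReal_inter_preimage_le {α β : Type*} [MeasurableSpace α] [MeasurableSpace β]
    [Countable β] [MeasurableSingletonClass β] {μ : Measure α} [IsFiniteMeasure μ] {f : α → β}
    (hf : Measurable f) {A : Set α} {S : Set β} {q : ℝ} (hq : 0 ≤ q)
    (h : ∀ b ∈ S, μ.real (A ∩ f ⁻¹' {b}) ≤ q * μ.real (f ⁻¹' {b})) :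
    μ.real (A ∩ f ⁻¹' S) ≤ q * μ.real (f ⁻¹' S) := by
  have hcover : A ∩ f ⁻¹' S = ⋃ b : S, A ∩ f ⁻¹' {b.1} := by ext; simp
  have hfiber : ∀ b ∈ S, μ (A ∩ f ⁻¹' {b}) ≤ ENNReal.ofReal q * μ (f ⁻¹' {b}) := fun b hb => by
    rw [← ofReal_measureReal, ← ofReal_measureReal, ← ENNReal.ofReal_mul hq]
    exact ENNReal.ofReal_le_ofReal (h b hb)
  have hsum : μ (A ∩ f ⁻¹' S) ≤ ENNReal.ofReal q * μ (f ⁻¹' S) := calc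
    μ (A ∩ f ⁻¹' S) ≤ ∑' b : S, μ (A ∩ f ⁻¹' {b.1}) := hcover ▸ measure_iUnion_le _
    _ ≤ ∑' b : S, ENNReal.ofReal q * μ (f ⁻¹' {b.1}) :=
      ENNReal.tsum_le_tsum fun b => hfiber b b.2
    _ = ENNReal.ofReal q * μ (f ⁻¹' S) := by
      rw [ENNReal.tsum_mul_left,
        tsum_measure_preimage_singleton S.to_countable fun b _ => hf (measurableSet_singleton b)]
  rw [← ofReal_measureReal, ← ofReal_measureReal, ← ENNReal.ofReal_mul hq] at hsum
  exact (ENNReal.ofReal_le_ofReal_iff (by positivity)).1 hsum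

theorem ae_cons_one_of_ae {n : ℕ} {P : (Fin (n + 1) → ℝ) → Prop} (hP : ∀ᵐ X, P X)
    (hsmul : ∀ r : ℝ, 0 < r → ∀ X, P (r • X) → P X) :
    ∀ᵐ x : Fin n → ℝ, P (Fin.cons 1 x) := by
  have hprod : ∀ᵐ z : ℝ × (Fin n → ℝ), P (Fin.cons z.1 z.2) := by
    filter_upwards [((volume_preserving_piFinSuccAbove (fun _ : Fin (n + 1) => ℝ) 0).symm
      _).quasiMeasurePreserving.ae hP] with z hz
    simpa [MeasurableEquiv.piFinSuccAbove, Fin.consEquiv] using hz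
  have hslice : ∀ᵐ s : ℝ, ∀ᵐ x : Fin n → ℝ, P (Fin.cons s x) := Measure.ae_ae_of_ae_prod hprod
  obtain ⟨s, hs0, hs⟩ : ∃ s : ℝ, 0 < s ∧ ∀ᵐ x : Fin n → ℝ, P (Fin.cons s x) := by
    have : ∃ᶠ s in ae (volume : Measure ℝ), s ∈ Set.Ioi (0 : ℝ) := by
      rw [frequently_ae_mem_iff, Real.volume_Ioi]
      exact ENNReal.top_ne_zero
    exact (this.and_eventually hslice).exists
  filter_upwards [(Measure.quasiMeasurePreserving_smul volume hs0.ne').ae hs] with x hx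
  refine hsmul s hs0 _ ?_
  convert hx using 1
  ext j
  cases j using Fin.cases <;> simp

end General

section ExponentialLaw

variable {ι : Type*} [Fintype ι]

theorem measurePreserving_mulVec [DecidableEq ι] {M : Matrix ι ι ℝ} (hM : |M.det| = 1) :
    MeasurePreserving M.mulVec volume volume := by
  refine ⟨by fun_prop, ?_⟩
  have hdet : M.det ≠ 0 := fun h => by simp [h] at hM
  have := Real.map_matrix_volume_pi_eq_smul_volume_pi hdet
  rwa [abs_inv, hM, inv_one, ENNReal.ofReal_one, one_smul] at this

theorem measurableEmbedding_mulVec [DecidableEq ι] {M : Matrix ι ι ℝ} (hM : IsUnit M) :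
    MeasurableEmbedding M.mulVec :=
  Continuous.measurableEmbedding (by fun_prop) (mulVec_injective_of_isUnit hM)

/-- The open positive orthant, carrying the laws `expLaw`. -/
def orthant (ι : Type*) : Set (ι → ℝ) := {t | ∀ j, 0 < t j}

theorem measurableSet_orthant {ι : Type*} [Countable ι] : MeasurableSet (orthant ι) := by
  unfold orthant
  measurability

theorem smul_mem_orthant {ι : Type*} {r : ℝ} (hr : 0 < r) {t : ι → ℝ} :
    r • t ∈ orthant ι ↔ t ∈ orthant ι := by
  simp [orthant, hr]

/-- The joint law of independent exponential random variables of rates `L j`. -/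
noncomputable def expLaw (L : ι → ℝ) : Measure (ι → ℝ) :=
  (volume.restrict (orthant ι)).withDensity fun t =>
    ENNReal.ofReal ((∏ j, L j) * Real.exp (-(L ⬝ᵥ t)))

theorem expLaw_apply (L : ι → ℝ) (A : Set (ι → ℝ)) :
    expLaw L A =
      ∫⁻ t in A ∩ orthant ι, ENNReal.ofReal ((∏ j, L j) * Real.exp (-(L ⬝ᵥ t))) := by
  rw [expLaw, withDensity_apply', Measure.restrict_restrict' measurableSet_orthant]

theorem isProbabilityMeasure_expLaw {L : ι → ℝ} (hL : ∀ j, 0 < L j) :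
    IsProbabilityMeasure (expLaw L) := by
  have hdensity : ∀ t : ι → ℝ,
      (∏ j, L j) * Real.exp (-(L ⬝ᵥ t)) = ∏ j, L j * Real.exp (-L j * t j) := fun t => by
    rw [Finset.prod_mul_distrib, ← Real.exp_sum, dotProduct, ← Finset.sum_neg_distrib]
    simp only [neg_mul]
  have hint : ∀ j, Integrable (fun s : ℝ => L j * Real.exp (-L j * s))
      (volume.restrict (Set.Ioi 0)) := fun j =>
    (exp_neg_integrableOn_Ioi 0 (hL j)).const_mul (L j)
  have hpi : orthant ι = Set.univ.pi fun _ => Set.Ioi (0 : ℝ) := by ext; simp [orthant]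
  refine ⟨?_⟩
  rw [expLaw_apply, Set.univ_inter, hpi, volume_pi, Measure.restrict_pi_pi]
  simp only [hdensity]
  rw [← ofReal_integral_eq_lintegral_ofReal (Integrable.fintype_prod hint)
    (ae_of_all _ fun t => Finset.prod_nonneg fun j _ => mul_nonneg (hL j).le (Real.exp_pos _).le),
    integral_fintype_prod_eq_prod (𝕜 := ℝ) (fun j (s : ℝ) => L j * Real.exp (-L j * s)),
    Finset.prod_eq_one fun j _ => ?_, ENNReal.ofReal_one]
  rw [integral_const_mul, integral_exp_mul_Ioi (neg_lt_zero.2 (hL j))]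
  simp [(hL j).ne']

theorem ae_expLaw_iff {L : ι → ℝ} (hL : ∀ j, 0 < L j) {P : (ι → ℝ) → Prop} :
    (∀ᵐ t ∂expLaw L, P t) ↔ ∀ᵐ t, t ∈ orthant ι → P t := by
  have hpos : ∀ t : ι → ℝ, ENNReal.ofReal ((∏ j, L j) * Real.exp (-(L ⬝ᵥ t))) ≠ 0 := fun t =>
    (ENNReal.ofReal_pos.2 (mul_pos (Finset.prod_pos fun j _ => hL j) (Real.exp_pos _))).ne'
  rw [expLaw, ae_withDensity_iff (by unfold dotProduct; fun_prop),
    ae_restrict_iff' measurableSet_orthant]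
  simp only [hpos, ne_eq, not_false_eq_true, forall_const]

theorem expLaw_inter_eq [DecidableEq ι] {M : Matrix ι ι ℝ} (hM : |M.det| = 1) {L : ι → ℝ}
    (hL : ∀ j, 0 < L j) (hLM : ∀ j, 0 < (L ᵥ* M) j) {S : Set (ι → ℝ)}
    (hS : ∀ᵐ t, M *ᵥ t ∈ S ∩ orthant ι ↔ t ∈ orthant ι) (A : Set (ι → ℝ)) :
    expLaw L (A ∩ S) = ENNReal.ofReal ((∏ j, L j) / ∏ j, (L ᵥ* M) j) *
      expLaw (L ᵥ* M) (M.mulVec ⁻¹' A) := by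
  have hunit : IsUnit M := (isUnit_iff_isUnit_det M).2 <| isUnit_iff_ne_zero.2 fun h => by
    simp [h] at hM
  have hP : 0 < ∏ j, L j := Finset.prod_pos fun j _ => hL j
  have hQ : 0 < ∏ j, (L ᵥ* M) j := Finset.prod_pos fun j _ => hLM j
  have hset : (M.mulVec ⁻¹' (A ∩ S ∩ orthant ι) : Set (ι → ℝ)) =ᵐ[volume]
      (M.mulVec ⁻¹' A ∩ orthant ι : Set (ι → ℝ)) := by
    filter_upwards [hS] with t ht
    rw [Set.inter_assoc]
    exact propext (and_congr_right fun _ => ht)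
  -- `L ⬝ᵥ M *ᵥ t = L ᵥ* M ⬝ᵥ t`, so the density of rates `L` pulls back to that of rates `L ᵥ* M`.
  have hdensity : ∀ t, ENNReal.ofReal ((∏ j, L j) * Real.exp (-(L ⬝ᵥ M *ᵥ t))) =
      ENNReal.ofReal ((∏ j, L j) / ∏ j, (L ᵥ* M) j) *
        ENNReal.ofReal ((∏ j, (L ᵥ* M) j) * Real.exp (-(L ᵥ* M ⬝ᵥ t))) := fun t => by
    rw [← ENNReal.ofReal_mul (by positivity), dotProduct_mulVec]
    field_simp
  rw [expLaw_apply, expLaw_apply,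
    ← (measurePreserving_mulVec hM).setLIntegral_comp_preimage_emb
      (measurableEmbedding_mulVec hunit), setLIntegral_congr hset]
  simp only [hdensity]
  exact lintegral_const_mul _ (by unfold dotProduct; fun_prop)

end ExponentialLaw

section ConeMap

variable {d : ℕ}

/-- The digit of the triangle map in the homogeneous coordinates
`t = (1 - x₁, x₁ - x₂, …, xₙ₋₁ - xₙ, xₙ)`, see `coneDigit_toCone`. -/
noncomputable def coneDigit (t : Fin (d + 2) → ℝ) : ℕ := ⌊t 0 / t (Fin.last _)⌋₊

/-- The inverse branch of digit `b` of the triangle map in the coordinates of `coneDigit`; it is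
written as a product of matrices of determinant `±1`, and `branch_mulVec` gives its formula. -/
noncomputable def branch (b : ℕ) : Matrix (Fin (d + 2)) (Fin (d + 2)) ℝ :=
  transvection 0 (Fin.last _) (b : ℝ) * transvection (Fin.last _) 0 1 *
    Equiv.Perm.permMatrix ℝ (Equiv.subRight (1 : Fin (d + 2)))

/-- The triangle map in the coordinates of `coneDigit`, up to a positive factor; see
`coneMap_toCone`. -/
noncomputable def coneMap (t : Fin (d + 2) → ℝ) : Fin (d + 2) → ℝ :=
  (branch (coneDigit t))⁻¹ *ᵥ t

theorem abs_det_branch (b : ℕ) : |(branch b : Matrix (Fin (d + 2)) (Fin (d + 2)) ℝ).det| = 1 := by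
  have h : (0 : Fin (d + 2)) ≠ Fin.last _ := Fin.last_pos.ne
  rw [branch, det_mul, det_mul, det_transvection_of_ne _ _ h, det_transvection_of_ne _ _ h.symm,
    det_permutation, one_mul, one_mul]
  rcases Int.units_eq_one_or (Equiv.Perm.sign (Equiv.subRight (1 : Fin (d + 2)))) with h | h <;>
    simp [h]

theorem isUnit_det_branch (b : ℕ) :
    IsUnit (branch b : Matrix (Fin (d + 2)) (Fin (d + 2)) ℝ).det :=
  isUnit_iff_ne_zero.2 fun h => by simpa [h] using abs_det_branch (d := d) b

theorem branch_mulVec (b : ℕ) (t : Fin (d + 2) → ℝ) :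
    branch b *ᵥ t = Fin.cons (b * (t (Fin.last d).castSucc + t (Fin.last _)) + t (Fin.last _))
      (Fin.snoc (fun i : Fin d => t i.castSucc.castSucc)
        (t (Fin.last d).castSucc + t (Fin.last _)) : Fin (d + 1) → ℝ) := by
  have hsucc : ∀ i : Fin (d + 1), i.succ - 1 = i.castSucc := fun i => by
    rw [sub_eq_iff_eq_add, Fin.coeSucc_eq_succ]
  have hzero : (0 : Fin (d + 2)) - 1 = Fin.last _ := by
    rw [sub_eq_iff_eq_add, Fin.last_add_one]
  ext j
  simp only [branch, ← mulVec_mulVec, permMatrix_mulVec, transvection, add_mulVec, one_mulVec,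
    single_mulVec]
  cases j using Fin.cases with
  | zero =>
    simp [(Fin.succ_ne_zero _).symm, hzero, ← Fin.succ_last, hsucc]
    ring
  | succ i =>
    cases i using Fin.lastCases with
    | last => simp [hzero, ← Fin.succ_last, hsucc]
    | cast i => simp [hzero, ← Fin.succ_last, hsucc]

theorem vecMul_branch (b : ℕ) (L : Fin (d + 2) → ℝ) :
    L ᵥ* branch b = Fin.snoc
      (Fin.snoc (fun i : Fin d => L i.castSucc.succ) (L (Fin.last _) + b * L 0) : Fin (d + 1) → ℝ)
      (L (Fin.last _) + (b + 1) * L 0) := by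
  have hlast : Fin.last (d + 1) ≠ 0 := Fin.last_pos.ne'
  rw [← mulVec_transpose]
  ext j
  simp only [branch, transpose_mul, ← mulVec_mulVec, transpose_permMatrix, permMatrix_mulVec,
    transvection, transpose_add, transpose_one, transpose_single, add_mulVec, one_mulVec,
    single_mulVec]
  cases j using Fin.lastCases with
  | last => simp [hlast.symm, Fin.last_add_one]; ring
  | cast i =>
    cases i using Fin.lastCases with
    | last => simp [hlast]
    | cast i => simp

theorem vecMul_branch_last (L : Fin (d + 2) → ℝ) (b : ℕ) :
    (L ᵥ* branch b) (Fin.last _) = L (Fin.last _) + (b + 1) * L 0 := by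
  rw [vecMul_branch, Fin.snoc_last]

theorem coneMap_branch_mulVec {b : ℕ} {t : Fin (d + 2) → ℝ}
    (h : coneDigit (branch b *ᵥ t) = b) : coneMap (branch b *ᵥ t) = t := by
  rw [coneMap, h, mulVec_mulVec, nonsing_inv_mul _ (isUnit_det_branch b), one_mulVec]

theorem coneDigit_smul {r : ℝ} (hr : 0 < r) (t : Fin (d + 2) → ℝ) :
    coneDigit (r • t) = coneDigit t := by
  simp [coneDigit, mul_div_mul_left _ _ hr.ne']

theorem coneMap_smul {r : ℝ} (hr : 0 < r) (t : Fin (d + 2) → ℝ) :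
    coneMap (r • t) = r • coneMap t := by
  rw [coneMap, coneMap, coneDigit_smul hr, mulVec_smul]

theorem iterate_coneMap_smul {r : ℝ} (hr : 0 < r) (k : ℕ) (t : Fin (d + 2) → ℝ) :
    coneMap^[k] (r • t) = r • coneMap^[k] t := by
  induction k with
  | zero => rfl
  | succ k ih => simp only [Function.iterate_succ_apply', ih, coneMap_smul hr]

theorem measurable_coneDigit : Measurable (coneDigit (d := d)) := by
  unfold coneDigit
  fun_prop

theorem branch_mulVec_mem_iff (b : ℕ) {t : Fin (d + 2) → ℝ} (ht : t (Fin.last _) ≠ 0) :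
    branch b *ᵥ t ∈ coneDigit ⁻¹' {b} ∩ orthant _ ↔ t ∈ orthant _ := by
  set x := t (Fin.last d).castSucc with hx
  set y := t (Fin.last _) with hy
  have himage : branch b *ᵥ t ∈ orthant _ ↔
      0 < b * (x + y) + y ∧ (∀ i : Fin d, 0 < t i.castSucc.castSucc) ∧ 0 < x + y := by
    simp only [orthant, branch_mulVec, Set.mem_ofPred_eq, Fin.forall_fin_succ (n := d + 1),
      Fin.forall_fin_succ' (n := d), Fin.cons_zero, Fin.cons_succ, Fin.snoc_castSucc,
      Fin.snoc_last, hx, hy]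
  have hsource : t ∈ orthant _ ↔ ((∀ i : Fin d, 0 < t i.castSucc.castSucc) ∧ 0 < x) ∧ 0 < y := by
    simp only [orthant, Set.mem_ofPred_eq, Fin.forall_fin_succ', hx, hy]
  have hdigit : 0 < b * (x + y) + y → 0 < x + y →
      (coneDigit (branch b *ᵥ t) = b ↔ 0 ≤ y ∧ 0 < x) := fun h0 hlast => by
    rw [coneDigit, branch_mulVec, ← Fin.succ_last, Fin.cons_zero, Fin.cons_succ, Fin.snoc_last,
      Fin.succ_last, Nat.floor_eq_iff (by positivity), le_div_iff₀ hlast, div_lt_iff₀ hlast]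
    constructor <;> rintro ⟨h1, h2⟩ <;> constructor <;> linarith
  rw [Set.mem_inter_iff, Set.mem_preimage, Set.mem_singleton_iff, himage, hsource]
  constructor
  · rintro ⟨hb, h0, hmid, hlast⟩
    obtain ⟨hy0, hx0⟩ := (hdigit h0 hlast).1 hb
    exact ⟨⟨hmid, hx0⟩, hy0.lt_of_ne' ht⟩
  · rintro ⟨⟨hmid, hx0⟩, hy0⟩
    have h0 : 0 < b * (x + y) + y := by positivity
    exact ⟨(hdigit h0 (by positivity)).2 ⟨hy0.le, hx0⟩, h0, hmid, by positivity⟩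

theorem ae_branch_mulVec_mem_iff (b : ℕ) : ∀ᵐ t : Fin (d + 2) → ℝ,
    branch b *ᵥ t ∈ coneDigit ⁻¹' {b} ∩ orthant _ ↔ t ∈ orthant _ := by
  have hlast : ∀ᵐ t : Fin (d + 2) → ℝ, t (Fin.last _) ≠ 0 :=
    Measure.ae_eval_ne (μ := fun _ : Fin (d + 2) => (volume : Measure ℝ)) (Fin.last _) 0
  exact hlast.mono fun t => branch_mulVec_mem_iff b

end ConeMap

section Digits

variable {d : ℕ} {L : Fin (d + 2) → ℝ}

theorem vecMul_branch_pos (hL : ∀ j, 0 < L j) (b : ℕ) (j : Fin (d + 2)) :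
    0 < (L ᵥ* branch b) j := by
  have h0 := hL 0
  have hlast := hL (Fin.last _)
  rw [vecMul_branch]
  cases j using Fin.lastCases with
  | last => rw [Fin.snoc_last]; positivity
  | cast i =>
    rw [Fin.snoc_castSucc]
    cases i using Fin.lastCases with
    | last => rw [Fin.snoc_last]; positivity
    | cast i => rw [Fin.snoc_castSucc]; exact hL _

theorem prod_div_prod_vecMul_branch (hL : ∀ j, 0 < L j) (b : ℕ) :
    (∏ j, L j) / ∏ j, (L ᵥ* branch b) j = L (Fin.last _) * L 0 /
      ((L (Fin.last _) + b * L 0) * (L (Fin.last _) + (b + 1) * L 0)) := by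
  have h0 := hL 0
  have hlast := hL (Fin.last _)
  have hmid : 0 < ∏ i : Fin d, L i.castSucc.succ := Finset.prod_pos fun i _ => hL _
  have hprod : ∏ j, L j = L 0 * ((∏ i : Fin d, L i.castSucc.succ) * L (Fin.last _)) := by
    rw [Fin.prod_univ_succ, Fin.prod_univ_castSucc, Fin.succ_last]
  rw [vecMul_branch, Fin.prod_snoc, Fin.prod_snoc, hprod]
  field_simp

theorem expLaw_real_inter_coneDigit_eq (hL : ∀ j, 0 < L j) (b : ℕ) (A : Set (Fin (d + 2) → ℝ)) :
    (expLaw L).real (A ∩ coneDigit ⁻¹' {b}) =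
      (∏ j, L j) / (∏ j, (L ᵥ* branch b) j) *
        (expLaw (L ᵥ* branch b)).real ((branch b).mulVec ⁻¹' A) := by
  have hchild := vecMul_branch_pos hL b
  rw [measureReal_def, expLaw_inter_eq (abs_det_branch b) hL hchild (ae_branch_mulVec_mem_iff b) A,
    ENNReal.toReal_mul, ENNReal.toReal_ofReal, measureReal_def]
  exact div_nonneg (Finset.prod_nonneg fun j _ => (hL j).le)
    (Finset.prod_nonneg fun j _ => (hchild j).le)

theorem expLaw_real_coneDigit_eq (hL : ∀ j, 0 < L j) (b : ℕ) :
    (expLaw L).real (coneDigit ⁻¹' {b}) = (∏ j, L j) / ∏ j, (L ᵥ* branch b) j := by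
  have := isProbabilityMeasure_expLaw (vecMul_branch_pos hL b)
  simpa using expLaw_real_inter_coneDigit_eq hL b Set.univ

theorem expLaw_real_coneDigit_lt (hL : ∀ j, 0 < L j) (J : ℕ) :
    (expLaw L).real (coneDigit ⁻¹' Set.Iio J) = J * L 0 / (L (Fin.last _) + J * L 0) := by
  have := isProbabilityMeasure_expLaw hL
  have h0 := hL 0
  have hlast := hL (Fin.last _)
  rw [← Finset.coe_Iio, ← sum_measureReal_preimage_singleton _ fun b _ =>
    measurable_coneDigit (measurableSet_singleton b), Nat.Iio_eq_range]
  simp only [expLaw_real_coneDigit_eq hL, prod_div_prod_vecMul_branch hL]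
  induction J with
  | zero => simp
  | succ J ih =>
    rw [Finset.sum_range_succ, ih]
    push_cast
    field_simp
    ring

theorem expLaw_real_inter_coneDigit_le (hL : ∀ j, 0 < L j) (b : ℕ) {A B : Set (Fin (d + 2) → ℝ)}
    (hAB : ∀ t ∈ A, coneDigit t = b → coneMap t ∈ B) :
    (expLaw L).real (A ∩ coneDigit ⁻¹' {b}) ≤
      (expLaw (L ᵥ* branch b)).real B * (expLaw L).real (coneDigit ⁻¹' {b}) := by
  have hchild := vecMul_branch_pos hL b
  have := isProbabilityMeasure_expLaw hchild
  have hmono : (expLaw (L ᵥ* branch b)).real ((branch b).mulVec ⁻¹' A) ≤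
      (expLaw (L ᵥ* branch b)).real B := by
    refine ENNReal.toReal_mono (measure_ne_top _ _)
      (measure_mono_ae ((ae_expLaw_iff hchild).2 ?_))
    filter_upwards [ae_branch_mulVec_mem_iff b] with t ht ht0 htA
    have hb : coneDigit (branch b *ᵥ t) = b := (ht.2 ht0).1
    have hB := hAB _ htA hb
    rwa [coneMap_branch_mulVec hb] at hB
  rw [expLaw_real_inter_coneDigit_eq hL, ← expLaw_real_coneDigit_eq hL, mul_comm]
  exact mul_le_mul_of_nonneg_right hmono measureReal_nonneg

end Digits

section Avoidance

variable {d : ℕ} {L : Fin (d + 2) → ℝ}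

theorem expLaw_real_le_sub_mul (hL : ∀ j, 0 < L j) {A : Set (Fin (d + 2) → ℝ)}
    {B : ℕ → Set (Fin (d + 2) → ℝ)} (hAB : ∀ t ∈ A, coneMap t ∈ B (coneDigit t))
    {S : Set ℕ} {p q δ : ℝ} (hqp : q ≤ p)
    (hq : ∀ b ∈ S, (expLaw (L ᵥ* branch b)).real (B b) ≤ q)
    (hp : ∀ b, (expLaw (L ᵥ* branch b)).real (B b) ≤ p)
    (hδ : δ ≤ (expLaw L).real (coneDigit ⁻¹' S)) :
    (expLaw L).real A ≤ p - (p - q) * δ := by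
  have := isProbabilityMeasure_expLaw hL
  have hfiber : ∀ (R : Set ℕ) (r : ℝ), (∀ b ∈ R, (expLaw (L ᵥ* branch b)).real (B b) ≤ r) →
      (expLaw L).real (A ∩ coneDigit ⁻¹' R) ≤ r * (expLaw L).real (coneDigit ⁻¹' R) := by
    intro R r hr
    rcases R.eq_empty_or_nonempty with rfl | ⟨b, hb⟩
    · simp
    · refine measureReal_inter_preimage_le measurable_coneDigit
        (measureReal_nonneg.trans (hr b hb)) fun c hc => ?_
      refine (expLaw_real_inter_coneDigit_le hL c fun t ht htc => htc ▸ hAB t ht).trans ?_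
      exact mul_le_mul_of_nonneg_right (hr c hc) measureReal_nonneg
  have hmeas : MeasurableSet (coneDigit (d := d) ⁻¹' S) := measurable_coneDigit .of_discrete
  have hcompl := probReal_compl_eq_one_sub (μ := expLaw L) hmeas
  calc (expLaw L).real A
      = (expLaw L).real (A ∩ coneDigit ⁻¹' S) + (expLaw L).real (A ∩ coneDigit ⁻¹' Sᶜ) :=
        (measureReal_inter_add_sdiff hmeas).symm
    _ ≤ q * (expLaw L).real (coneDigit ⁻¹' S) + p * (expLaw L).real (coneDigit ⁻¹' Sᶜ) :=
        add_le_add (hfiber S q hq) (hfiber Sᶜ p fun b _ => hp b)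
    _ = p - (p - q) * (expLaw L).real (coneDigit ⁻¹' S) := by
        rw [Set.preimage_compl, hcompl]
        ring
    _ ≤ p - (p - q) * δ := by
        have := mul_le_mul_of_nonneg_left hδ (sub_nonneg.2 hqp)
        linarith

/-- Positive nondecreasing rates. The rates reached from `(1, …, 1)` by `L ↦ L ᵥ* branch b` are
of this form; they are the denominators of the vertices of the cylinders of the triangle map. -/
structure IsRate (L : Fin (d + 2) → ℝ) : Prop where
  pos : ∀ j, 0 < L j
  mono : Monotone L

theorem IsRate.le_vecMul_branch (hL : IsRate L) (b : ℕ) (i : Fin (d + 1)) :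
    L i.succ ≤ (L ᵥ* branch b) i.castSucc := by
  have h0 := hL.pos 0
  rw [vecMul_branch, Fin.snoc_castSucc]
  cases i using Fin.lastCases with
  | last =>
    rw [Fin.snoc_last, Fin.succ_last]
    exact le_add_of_nonneg_right (by positivity)
  | cast i => rw [Fin.snoc_castSucc]

theorem IsRate.vecMul_branch (hL : IsRate L) (b : ℕ) : IsRate (L ᵥ* branch b) := by
  have h0 := hL.pos 0
  refine ⟨vecMul_branch_pos hL.pos b, Fin.monotone_iff_le_succ.2 fun i => ?_⟩
  cases i using Fin.lastCases with
  | last =>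
    rw [Fin.succ_last, vecMul_branch_last, TriangleMap.vecMul_branch, Fin.snoc_castSucc,
      Fin.snoc_last]
    linarith
  | cast i =>
    rw [Fin.succ_castSucc]
    refine le_trans ?_ (hL.le_vecMul_branch b i.succ)
    rw [TriangleMap.vecMul_branch, Fin.snoc_castSucc, Fin.snoc_castSucc]
    exact hL.mono (Fin.succ_le_succ_iff.2 Fin.castSucc_lt_succ.le)

theorem IsRate.le_expLaw_real_coneDigit (hL : IsRate L) {ρ : ℝ} (hρ : L (Fin.last _) ≤ ρ * L 0)
    (b : ℕ) : 1 / (ρ + b + 1) ^ 2 ≤ (expLaw L).real (coneDigit ⁻¹' {b}) := by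
  have h0 := hL.pos 0
  have hl : L 0 ≤ L (Fin.last _) := hL.mono (Fin.zero_le _)
  have hρ1 : 1 ≤ ρ := le_of_mul_le_mul_right (by linarith) h0
  have hfactor : L (Fin.last _) + (b + 1) * L 0 ≤ (ρ + b + 1) * L 0 := by linarith
  rw [expLaw_real_coneDigit_eq hL.pos, prod_div_prod_vecMul_branch hL.pos]
  calc 1 / (ρ + b + 1) ^ 2
      = L 0 * L 0 / (((ρ + b + 1) * L 0) * ((ρ + b + 1) * L 0)) := by field_simp
    _ ≤ L (Fin.last _) * L 0 /
          ((L (Fin.last _) + b * L 0) * (L (Fin.last _) + (b + 1) * L 0)) := by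
      have hpos : 0 < L (Fin.last _) := h0.trans_le hl
      gcongr
      linarith

/-- The cylinder of points whose first digits form the word `w`. -/
def cylinder {m : ℕ} (w : Fin m → ℕ) : Set (Fin (d + 2) → ℝ) :=
  {t | ∀ i : Fin m, coneDigit (coneMap^[i] t) = w i}

theorem mem_cylinder_succ {m : ℕ} {w : Fin (m + 1) → ℕ} {t : Fin (d + 2) → ℝ} :
    t ∈ cylinder w ↔ coneDigit t = w 0 ∧ coneMap t ∈ cylinder (Fin.tail w) := by
  simp [cylinder, Fin.forall_fin_succ, Fin.tail]

variable {N : Set (Fin (d + 2) → ℝ)} {p : ℝ}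

theorem exists_expLaw_real_diff_cylinder_le (hN : Set.MapsTo coneMap N N) (hp0 : 0 < p)
    (hp : ∀ L : Fin (d + 2) → ℝ, IsRate L → (expLaw L).real N ≤ p) {m : ℕ} (w : Fin m → ℕ)
    {ρ : ℝ} (hρ : 0 < ρ) : ∃ q < p, ∀ L : Fin (d + 2) → ℝ, IsRate L →
      L (Fin.last _) ≤ ρ * L 0 → (expLaw L).real (N \ cylinder w) ≤ q := by
  induction m generalizing ρ with
  | zero => exact ⟨0, hp0, fun L _ _ => by simp [cylinder]⟩
  | succ m ih =>
    obtain ⟨q, hqp, hq⟩ := ih (Fin.tail w) (ρ := ρ + w 0 + 1) (by positivity)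
    refine ⟨p - (p - q) * (1 / (ρ + w 0 + 1) ^ 2),
      sub_lt_self _ (mul_pos (sub_pos.2 hqp) (by positivity)), fun L hL hLρ => ?_⟩
    refine expLaw_real_le_sub_mul hL.pos (S := {w 0})
      (B := fun b => N \ {t | b = w 0 ∧ t ∈ cylinder (Fin.tail w)})
      (fun t ht => ⟨hN ht.1, fun h => ht.2 (mem_cylinder_succ.2 h)⟩) hqp.le ?_ ?_
      (hL.le_expLaw_real_coneDigit hLρ _)
    · rintro _ rfl
      have hchild0 : L 0 ≤ (L ᵥ* branch (w 0)) 0 :=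
        (hL.mono (Fin.zero_le _)).trans (hL.le_vecMul_branch (w 0) 0)
      have hbalance :
          (L ᵥ* branch (w 0)) (Fin.last _) ≤ (ρ + w 0 + 1) * (L ᵥ* branch (w 0)) 0 := by
        rw [vecMul_branch_last]
        refine le_trans ?_ (mul_le_mul_of_nonneg_left hchild0 (by positivity))
        linarith
      simpa using hq _ (hL.vecMul_branch _) hbalance
    · intro b
      have := isProbabilityMeasure_expLaw (hL.vecMul_branch b).pos
      exact (measureReal_mono Set.sdiff_subset).trans (hp _ (hL.vecMul_branch b))

theorem exists_expLaw_real_le_of_disjoint_cylinder (hN : Set.MapsTo coneMap N N) (hp0 : 0 < p)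
    (hp : ∀ L : Fin (d + 2) → ℝ, IsRate L → (expLaw L).real N ≤ p) {m : ℕ} {w : Fin m → ℕ}
    (hw : Disjoint N (cylinder w)) (i : Fin (d + 2)) {ρ : ℝ} (hρ : 0 < ρ) :
    ∃ q < p, ∀ L : Fin (d + 2) → ℝ, IsRate L →
      L (Fin.last _) ≤ ρ * L i → (expLaw L).real N ≤ q := by
  induction i using Fin.induction generalizing ρ with
  | zero => simpa only [hw.sdiff_eq_left] using exists_expLaw_real_diff_cylinder_le hN hp0 hp w hρ
  | succ i ih =>
    obtain ⟨q, hqp, hq⟩ := ih (ρ := 3 * ρ) (by positivity)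
    refine ⟨p - (p - q) * (1 / 2), by linarith, fun L hL hLρ => ?_⟩
    have h0 := hL.pos 0
    have hl := hL.pos (Fin.last _)
    have h0l : L 0 ≤ L (Fin.last _) := hL.mono (Fin.zero_le _)
    -- With probability at least `1 / 2` the first digit is at most `L (Fin.last _) / L 0`; then the
    -- last rate at most triples, while the rate at `i.succ` moves down to `i.castSucc`.
    set J : ℕ := ⌊L (Fin.last _) / L 0⌋₊ + 1 with hJ
    refine expLaw_real_le_sub_mul hL.pos (S := Set.Iio J) (B := fun _ => N) (fun t ht => hN ht)
      hqp.le (fun b hb => hq _ (hL.vecMul_branch b) ?_) (fun b => hp _ (hL.vecMul_branch b)) ?_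
    · have hbJ : b * L 0 ≤ L (Fin.last _) := by
        rw [← le_div_iff₀ h0, ← Nat.le_floor_iff (by positivity)]
        exact Nat.lt_succ_iff.1 hb
      have := mul_le_mul_of_nonneg_left (hL.le_vecMul_branch b i) hρ.le
      rw [vecMul_branch_last]
      linarith
    · have hJl : L (Fin.last _) ≤ J * L 0 := by
        rw [← div_le_iff₀ h0, hJ, Nat.cast_succ]
        exact (Nat.lt_floor_add_one _).le
      rw [expLaw_real_coneDigit_lt hL.pos, div_le_div_iff₀ two_pos (by positivity)]
      linarith

theorem expLaw_real_eq_zero_of_disjoint_cylinder (hN : Set.MapsTo coneMap N N) {m : ℕ}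
    {w : Fin m → ℕ} (hw : Disjoint N (cylinder w)) (hL : IsRate L) : (expLaw L).real N = 0 := by
  have hne : Nonempty {L : Fin (d + 2) → ℝ // IsRate L} := ⟨⟨L, hL⟩⟩
  have hbdd : BddAbove (Set.range fun L : {L : Fin (d + 2) → ℝ // IsRate L} =>
      (expLaw L.1).real N) := by
    refine ⟨1, ?_⟩
    rintro _ ⟨L, rfl⟩
    have := isProbabilityMeasure_expLaw L.2.pos
    exact measureReal_le_one
  set p := ⨆ L : {L : Fin (d + 2) → ℝ // IsRate L}, (expLaw L.1).real N
  have hp : ∀ L : Fin (d + 2) → ℝ, IsRate L → (expLaw L).real N ≤ p := fun L hL =>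
    le_ciSup hbdd ⟨L, hL⟩
  refine ((hp L hL).trans (not_lt.1 fun hp0 => ?_)).antisymm measureReal_nonneg
  obtain ⟨q, hqp, hq⟩ :=
    exists_expLaw_real_le_of_disjoint_cylinder hN hp0 hp hw (Fin.last _) one_pos
  exact hqp.not_ge (ciSup_le fun L => hq L L.2 (one_mul _).ge)

theorem isRate_one : IsRate (1 : Fin (d + 2) → ℝ) := ⟨fun _ => one_pos, monotone_const⟩

theorem ae_comp_iterate_coneMap {P : (Fin (d + 2) → ℝ) → Prop}
    (hP : ∀ᵐ t, t ∈ orthant _ → P t) (k : ℕ) :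
    ∀ᵐ t, t ∈ orthant _ → P (coneMap^[k] t) := by
  induction k with
  | zero => exact hP
  | succ k ih =>
    have hone := isRate_one (d := d)
    have := isProbabilityMeasure_expLaw hone.pos
    have hnull : ∀ b, (expLaw (1 ᵥ* branch b)).real {t | ¬P (coneMap^[k] t)} ≤ 0 := fun b => by
      rw [measureReal_def, ae_iff.1 ((ae_expLaw_iff (hone.vecMul_branch b).pos).2 ih),
        ENNReal.toReal_zero]
    have hle := expLaw_real_le_sub_mul hone.pos (S := ∅) (A := {t | ¬P (coneMap^[k + 1] t)})
      (fun t ht => ht) le_rfl (fun b _ => hnull b) hnull measureReal_nonneg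
    refine (ae_expLaw_iff hone.pos).1 (ae_iff.2 ?_)
    rw [← measureReal_eq_zero_iff]
    exact (hle.trans_eq (by simp)).antisymm measureReal_nonneg

theorem ae_frequently_mem_cylinder {m : ℕ} (w : Fin m → ℕ) :
    ∀ᵐ t : Fin (d + 2) → ℝ, t ∈ orthant _ → ∃ᶠ k in atTop, coneMap^[k] t ∈ cylinder w := by
  set N : Set (Fin (d + 2) → ℝ) := {t | ∀ k, coneMap^[k] t ∉ cylinder w}
  have hmaps : Set.MapsTo coneMap N N := fun t ht k => ht (k + 1)
  have hdisj : Disjoint N (cylinder w) := Set.disjoint_left.2 fun t ht => ht 0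
  have hone := isRate_one (d := d)
  have := isProbabilityMeasure_expLaw hone.pos
  have hhit : ∀ᵐ t : Fin (d + 2) → ℝ, t ∈ orthant _ → ∃ k, coneMap^[k] t ∈ cylinder w := by
    refine (ae_expLaw_iff hone.pos).1 (ae_iff.2 ?_)
    simp only [not_exists]
    exact (measureReal_eq_zero_iff (measure_ne_top _ _)).1
      (expLaw_real_eq_zero_of_disjoint_cylinder hmaps hdisj hone)
  filter_upwards [ae_all_iff.2 (ae_comp_iterate_coneMap hhit)] with t ht ht0
  refine frequently_atTop.2 fun K => ?_
  obtain ⟨k, hk⟩ := ht K ht0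
  exact ⟨k + K, Nat.le_add_left K k, by rwa [Function.iterate_add_apply]⟩

end Avoidance

section Simplex

variable {d : ℕ}

/-- The linear map `(X₀, …, Xₙ) ↦ (X₀ - X₁, …, Xₙ₋₁ - Xₙ, Xₙ)`; it carries the nonincreasing
nonnegative sequences onto the closed positive orthant. -/
def gaps : (Fin (d + 2) → ℝ) →ₗ[ℝ] (Fin (d + 2) → ℝ) where
  toFun X := Fin.snoc (α := fun _ => ℝ) (fun i : Fin (d + 1) => X i.castSucc - X i.succ)
    (X (Fin.last _))
  map_add' X Y := by
    ext j
    cases j using Fin.lastCases <;> simp [add_sub_add_comm]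
  map_smul' r X := by
    ext j
    cases j using Fin.lastCases <;> simp [mul_sub]

theorem gaps_castSucc (X : Fin (d + 2) → ℝ) (i : Fin (d + 1)) :
    gaps X i.castSucc = X i.castSucc - X i.succ := by
  simp [gaps]

theorem gaps_last (X : Fin (d + 2) → ℝ) : gaps X (Fin.last _) = X (Fin.last _) := by
  simp [gaps]

theorem gaps_injective : Function.Injective (gaps (d := d)) := by
  rw [injective_iff_map_eq_zero]
  intro X hX
  ext j
  induction j using Fin.reverseInduction with
  | last => rw [← gaps_last X, hX]
  | cast i ih =>
    have hi : X i.castSucc - X i.succ = 0 := by rw [← gaps_castSucc X, hX, Pi.zero_apply]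
    rwa [ih, Pi.zero_apply, sub_zero] at hi

/-- The coordinates `(1 - x₁, x₁ - x₂, …, xₙ₋₁ - xₙ, xₙ)` in which the triangle map becomes
`coneMap`, up to a positive factor. -/
def toCone (x : Fin (d + 1) → ℝ) : Fin (d + 2) → ℝ := gaps (Fin.cons 1 x)

theorem toCone_zero (x : Fin (d + 1) → ℝ) : toCone x 0 = 1 - x 0 :=
  (gaps_castSucc _ 0).trans (by simp)

theorem toCone_succ_castSucc (x : Fin (d + 1) → ℝ) (i : Fin d) :
    toCone x i.castSucc.succ = x i.castSucc - x i.succ := by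
  rw [toCone, Fin.succ_castSucc, gaps_castSucc, ← Fin.succ_castSucc, Fin.cons_succ, Fin.cons_succ]

theorem toCone_last (x : Fin (d + 1) → ℝ) : toCone x (Fin.last _) = x (Fin.last _) := by
  rw [toCone, gaps_last, ← Fin.succ_last, Fin.cons_succ]

theorem toCone_nonneg {x : Fin (d + 1) → ℝ} (hx : x ∈ simplex d) (j : Fin (d + 2)) :
    0 ≤ toCone x j := by
  obtain ⟨h1, hanti, h0⟩ := hx
  cases j using Fin.cases with
  | zero => rwa [toCone_zero, sub_nonneg]
  | succ i =>
    cases i using Fin.lastCases with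
    | last => rwa [Fin.succ_last, toCone_last]
    | cast i =>
      rw [toCone_succ_castSucc, sub_nonneg]
      exact hanti Fin.castSucc_lt_succ.le

theorem mem_cell_digit {x : Fin (d + 1) → ℝ} (hx : toCone x ∈ orthant _) :
    x ∈ cell d (digit x) := by
  have h0 : 0 < 1 - x 0 := toCone_zero x ▸ hx 0
  have hlast : 0 < x (Fin.last d) := toCone_last x ▸ hx (Fin.last _)
  have hanti : Antitone x := Fin.antitone_iff_succ_le.2 fun i =>
    (sub_pos.1 (toCone_succ_castSucc x i ▸ hx i.castSucc.succ)).le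
  have hfloor := Nat.floor_le (div_pos h0 hlast).le
  have hlt := Nat.lt_floor_add_one ((1 - x 0) / x (Fin.last d))
  rw [le_div_iff₀ hlast] at hfloor
  rw [div_lt_iff₀ hlast] at hlt
  exact ⟨⟨(sub_pos.1 h0).le, hanti, hlast.le⟩, sub_nonneg.2 hfloor, sub_neg.2 hlt⟩

theorem apply_zero_pos {x : Fin (d + 1) → ℝ} (hx : toCone x ∈ orthant _) : 0 < x 0 :=
  (toCone_last x ▸ hx (Fin.last _)).trans_le ((mem_cell_digit hx).1.2.1 (Fin.zero_le _))

theorem coneDigit_toCone (x : Fin (d + 1) → ℝ) : coneDigit (toCone x) = digit x := by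
  rw [coneDigit, digit, toCone_zero, toCone_last]

theorem branch_mulVec_gaps_snoc (b : ℕ) (x : Fin (d + 1) → ℝ) :
    branch b *ᵥ gaps (Fin.snoc x (1 - x 0 - b * x (Fin.last _)) : Fin (d + 2) → ℝ) =
      toCone x := by
  set X : Fin (d + 2) → ℝ := Fin.snoc x (1 - x 0 - b * x (Fin.last _))
  have hX : ∀ i : Fin (d + 1), X i.castSucc = x i := Fin.snoc_castSucc (α := fun _ => ℝ) _ x
  have hlast : gaps X (Fin.last _) = 1 - x 0 - b * x (Fin.last _) := by simp [gaps_last, X]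
  have hsum : gaps X (Fin.last d).castSucc + gaps X (Fin.last _) = x (Fin.last _) := by
    rw [gaps_castSucc, gaps_last, Fin.succ_last, sub_add_cancel, hX]
  rw [branch_mulVec, hsum, hlast]
  ext j
  cases j using Fin.cases with
  | zero =>
    rw [Fin.cons_zero, toCone_zero]
    ring
  | succ i =>
    rw [Fin.cons_succ]
    cases i using Fin.lastCases with
    | last => rw [Fin.snoc_last, Fin.succ_last, toCone_last]
    | cast i =>
      rw [Fin.snoc_castSucc, toCone_succ_castSucc, gaps_castSucc, Fin.succ_castSucc, hX, hX]

theorem cons_one_T {x : Fin (d + 1) → ℝ} (hx : x 0 ≠ 0) :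
    (Fin.cons 1 (T x) : Fin (d + 2) → ℝ) =
      (x 0)⁻¹ • Fin.snoc x (1 - x 0 - digit x * x (Fin.last _)) := by
  ext j
  cases j using Fin.lastCases with
  | last => rw [← Fin.succ_last, Fin.cons_succ, T, Fin.snoc_last, Fin.succ_last, Pi.smul_apply,
      Fin.snoc_last, smul_eq_mul, div_eq_inv_mul]
  | cast i =>
    cases i using Fin.cases with
    | zero => simp [hx]
    | succ i =>
      rw [← Fin.succ_castSucc, Fin.cons_succ, T, Fin.snoc_castSucc, Fin.succ_castSucc,
        Pi.smul_apply, Fin.snoc_castSucc, smul_eq_mul, div_eq_inv_mul]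

theorem coneMap_toCone {x : Fin (d + 1) → ℝ} (hx : x 0 ≠ 0) :
    coneMap (toCone x) = x 0 • toCone (T x) := by
  have hbranch := branch_mulVec_gaps_snoc (digit x) x
  rw [toCone.eq_def (T x), cons_one_T hx, map_smul, smul_inv_smul₀ hx, ← hbranch]
  exact coneMap_branch_mulVec (by rw [hbranch, coneDigit_toCone])

theorem exists_iterate_coneMap_toCone {x : Fin (d + 1) → ℝ}
    (hx : ∀ k, coneMap^[k] (toCone x) ∈ orthant _) (k : ℕ) :
    ∃ r : ℝ, 0 < r ∧ coneMap^[k] (toCone x) = r • toCone (T^[k] x) := by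
  induction k with
  | zero => exact ⟨1, one_pos, (one_smul ℝ _).symm⟩
  | succ k ih =>
    obtain ⟨r, hr, h⟩ := ih
    have hpos : 0 < (T^[k] x) 0 := apply_zero_pos ((smul_mem_orthant hr).1 (h ▸ hx k))
    refine ⟨r * (T^[k] x) 0, mul_pos hr hpos, ?_⟩
    rw [Function.iterate_succ_apply', h, coneMap_smul hr, coneMap_toCone hpos.ne', smul_smul,
      Function.iterate_succ_apply']

theorem coneDigit_iterate_toCone {x : Fin (d + 1) → ℝ}
    (hx : ∀ k, coneMap^[k] (toCone x) ∈ orthant _) (k : ℕ) :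
    coneDigit (coneMap^[k] (toCone x)) = digit (T^[k] x) := by
  obtain ⟨r, hr, h⟩ := exists_iterate_coneMap_toCone hx k
  rw [h, coneDigit_smul hr, coneDigit_toCone]

theorem isTriangleSequence_digit {x : Fin (d + 1) → ℝ}
    (hx : ∀ k, coneMap^[k] (toCone x) ∈ orthant _) :
    IsTriangleSequence x fun k => digit (T^[k] x) := fun k => by
  obtain ⟨r, hr, h⟩ := exists_iterate_coneMap_toCone hx k
  exact mem_cell_digit ((smul_mem_orthant hr).1 (h ▸ hx k))

theorem ae_toCone_of_ae {P : (Fin (d + 2) → ℝ) → Prop} (hP : ∀ᵐ t, P t)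
    (hsmul : ∀ r : ℝ, 0 < r → ∀ t, P (r • t) → P t) :
    ∀ᵐ x : Fin (d + 1) → ℝ, P (toCone x) := by
  have hdet : LinearMap.det (gaps (d := d)) ≠ 0 :=
    (LinearEquiv.isUnit_det' (LinearEquiv.ofInjectiveEndo _ gaps_injective)).ne_zero
  refine ae_cons_one_of_ae (P := fun X => P (gaps X))
    ((Measure.LinearMap.quasiMeasurePreserving volume _ hdet).ae hP) fun r hr X hX => ?_
  exact hsmul r hr _ (map_smul gaps r X ▸ hX)

theorem smul_mem_cylinder {r : ℝ} (hr : 0 < r) {m : ℕ} {w : Fin m → ℕ} {t : Fin (d + 2) → ℝ} :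
    r • t ∈ cylinder w ↔ t ∈ cylinder w := by
  simp only [cylinder, Set.mem_ofPred_eq, iterate_coneMap_smul hr, coneDigit_smul hr]

theorem ae_toCone_mem_orthant :
    ∀ᵐ x : Fin (d + 1) → ℝ, x ∈ simplex d → toCone x ∈ orthant _ := by
  have hne : ∀ᵐ t : Fin (d + 2) → ℝ, ∀ j, t j ≠ 0 := ae_all_iff.2 fun j =>
    Measure.ae_eval_ne (μ := fun _ : Fin (d + 2) => (volume : Measure ℝ)) j 0
  filter_upwards [ae_toCone_of_ae hne fun r _ t ht j htj => ht j (by simp [htj])] with x hx hmem j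
  exact (toCone_nonneg hmem j).lt_of_ne' (hx j)

theorem ae_iterate_coneMap_toCone_mem_orthant :
    ∀ᵐ x : Fin (d + 1) → ℝ, toCone x ∈ orthant _ →
      ∀ k, coneMap^[k] (toCone x) ∈ orthant _ := by
  have horbit : ∀ᵐ t : Fin (d + 2) → ℝ, ∀ k, t ∈ orthant _ → coneMap^[k] t ∈ orthant _ :=
    ae_all_iff.2 (ae_comp_iterate_coneMap (P := (· ∈ orthant _)) (ae_of_all _ fun _ => id))
  refine (ae_toCone_of_ae horbit fun r hr t ht k => ?_).mono fun x hx h0 k => hx k h0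
  simpa only [iterate_coneMap_smul hr, smul_mem_orthant hr] using ht k

theorem ae_frequently_toCone_mem_cylinder {m : ℕ} (w : Fin m → ℕ) :
    ∀ᵐ x : Fin (d + 1) → ℝ, toCone x ∈ orthant _ →
      ∃ᶠ k in atTop, coneMap^[k] (toCone x) ∈ cylinder w := by
  refine ae_toCone_of_ae (ae_frequently_mem_cylinder w) fun r hr t ht => ?_
  simpa only [iterate_coneMap_smul hr, smul_mem_orthant hr, smul_mem_cylinder hr] using ht

end Simplex

end TriangleMap

theorem mainTheorem4_general (d : ℕ) :
    ∀ᵐ x ∂(volume : Measure (Fin (d + 1) → ℝ)), x ∈ TriangleMap.simplex d →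
      ∃ b : ℕ → ℕ, TriangleMap.IsTriangleSequence x b ∧
        ∀ (m : ℕ) (w : Fin m → ℕ), {k : ℕ | ∀ i : Fin m, b (k + i) = w i}.Infinite := by
  have hwords := ae_all_iff.2 fun m => ae_all_iff.2 fun w : Fin m → ℕ =>
    TriangleMap.ae_frequently_toCone_mem_cylinder (d := d) w
  filter_upwards [TriangleMap.ae_toCone_mem_orthant,
    TriangleMap.ae_iterate_coneMap_toCone_mem_orthant, hwords] with x hpos horbit hfreq hx
  have hcone := horbit (hpos hx)
  refine ⟨_, TriangleMap.isTriangleSequence_digit hcone, fun m w => ?_⟩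
  refine Nat.frequently_atTop_iff_infinite.1 ((hfreq m w (hpos hx)).mono fun k hk i => ?_)
  rw [← TriangleMap.coneDigit_iterate_toCone hcone, add_comm k, Function.iterate_add_apply]
  exact hk i

/-- In dimension `n = d + 1`, strings of length `n - 1` have length `d`; a string is recorded by
the index `k` at which it starts. -/
theorem mainTheorem4 (d : ℕ) :
    (∀ᵐ x ∂(volume : Measure (Fin (d + 1) → ℝ)), x ∈ TriangleMap.simplex d →
      ∃ b : ℕ → ℕ, TriangleMap.IsTriangleSequence x b ∧
        {k : ℕ | ∀ i < d, b (k + i) = 0}.Infinite) ∧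
    (∀ B : ℝ, 0 ≤ B →
      ∀ᵐ x ∂(volume : Measure (Fin (d + 1) → ℝ)), x ∈ TriangleMap.simplex d →
        ∃ b : ℕ → ℕ, TriangleMap.IsTriangleSequence x b ∧
          {k : ℕ | ∀ i < d, (b (k + i) : ℝ) ≤ B}.Infinite) := by
  have h := mainTheorem4_general d
  refine ⟨h.mono fun x hx hmem => ?_, fun B hB => h.mono fun x hx hmem => ?_⟩ <;>
    obtain ⟨b, hb, hinf⟩ := hx hmem <;>
    refine ⟨b, hb, (hinf d 0).mono fun k hk i hi => ?_⟩
  · exact hk ⟨i, hi⟩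
  · simpa [hk ⟨i, hi⟩] using hB
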